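/- Let $A,B,C,X,Y,Z,\rho$ be complex numbers, put $\theta=2(AB+AC+BC)-(A^2+B^2+C^2)$, and consider the polynomial system $$\begin{aligned} &-2A^2X-2ABC+2ABX+2ABY+2ACX+2ACZ-2AX^2+2AXY+2AXZ-2AYZ-2B^2Y\\ &\quad+2BCY+2BCZ+2BXY-2BXZ-2BY^2+2BYZ-2C^2Z-2CXY+2CXZ+2CYZ-2CZ^2=0,\\ &\rho\,(2(AY+AZ+YZ)-A^2-Y^2-Z^2)-AYZ=0,\\ &\rho\,(2(BX+BZ+XZ)-X^2-B^2-Z^2)-BXZ=0,\\ &\rho\,(2(CX+CY+XY)-X^2-Y^2-C^2)-CXY=0 . \end{aligned}\tag{S}$$ (If $A,B,C$ are the squared side lengths of a triangle with vertices $v_0,v_1,v_2$, where $A=\|v_1-v_2\|^2$, $B=\|v_0-v_2\|^2$, $C=\|v_0-v_1\|^2$, and $X,Y,Z$ are the squared distances of a point $P$ of its plane from $v_0,v_1,v_2$, then these equations are the vanishing, up to constant factors, of the Cayley--Menger determinants expressing that $P$ lies in the plane of the triangle and that $P$ lies, for each side of the triangle, on a circle of squared radius $\rho$ through the endpoints of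 that side.) There exists an irreducible algebraic subvariety $W\subset\mathbb{C}^6$ of codimension $2$ and degree $6$ such that the set of solutions $(A,B,C,X,Y,Z,\rho)\in\mathbb{C}^7$ of (S) is exactly the union of the following three sets: 1. the set of $(A,B,C,X,Y,Z,\rho)$ with $\theta\neq0$, $\rho=\frac{ABC}{\theta}$ and $(X,Y,Z)=\left(\frac{A(B+C-A)^2}{\theta},\frac{B(A+C-B)^2}{\theta},\frac{C(A+B-C)^2}{\theta}\right)$; 2. the set of $(A,B,C,X,Y,Z,\rho)$ with $\theta\neq0$, $\rho=\frac{ABC}{\theta}$ and $(A,B,C,X,Y,Z)\in W$; 3. the degenerate solutions, that is, the solutions of (S) with $\rho=0$ or $A=0$ or $B=0$ or $C=0$ or $\theta=0$. Here the degree of $W$ is $m!$ times the leading coefficient of its affine Hilbert polynomial (the polynomial giving, for large $s$, the dimension of the space of polynomials of total degree at most $s$ modulo those vanishing on $W$), where $m$ is the degree of that polynomial; equivalently, it is the degree of the projective closure of $W$. -/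

import Mathlib

open MvPolynomial Filter
open scoped Nat

noncomputable section

/-! ### The polynomial system -/

/-- `θ = 2(AB+AC+BC) - (A²+B²+C²)`; for squared side lengths of a triangle this is
`16` times the square of its area. -/
def theta (A B C : ℂ) : ℂ := 2 * (A * B + A * C + B * C) - (A ^ 2 + B ^ 2 + C ^ 2)

/-- The planar system in distance coordinates. The first equation is the vanishing of the
Cayley-Menger determinant of the triangle and the point with distance coordinates `(X, Y, Z)`;
the other three are (up to a constant factor) the Cayley-Menger determinants of two vertices, the
point, and the centre of a circle of squared radius `ρ` through these three points. -/
def SolvesPlanarSystem (A B C X Y Z ρ : ℂ) : Prop :=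
  (-2 * A ^ 2 * X - 2 * A * B * C + 2 * A * B * X + 2 * A * B * Y + 2 * A * C * X + 2 * A * C * Z
      - 2 * A * X ^ 2 + 2 * A * X * Y + 2 * A * X * Z - 2 * A * Y * Z - 2 * B ^ 2 * Y
      + 2 * B * C * Y + 2 * B * C * Z + 2 * B * X * Y - 2 * B * X * Z - 2 * B * Y ^ 2
      + 2 * B * Y * Z - 2 * C ^ 2 * Z - 2 * C * X * Y + 2 * C * X * Z + 2 * C * Y * Z
      - 2 * C * Z ^ 2 = 0) ∧
  (ρ * (2 * (A * Y + A * Z + Y * Z) - A ^ 2 - Y ^ 2 - Z ^ 2) - A * Y * Z = 0) ∧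
  (ρ * (2 * (B * X + B * Z + X * Z) - X ^ 2 - B ^ 2 - Z ^ 2) - B * X * Z = 0) ∧
  (ρ * (2 * (C * X + C * Y + X * Y) - X ^ 2 - Y ^ 2 - C ^ 2) - C * X * Y = 0)

/-! ### Affine varieties: irreducibility, codimension, degree -/

/-- An algebraic subset of affine `n`-space: the common zero locus of an ideal of polynomials. -/
def IsAlgebraicSet {n : ℕ} (W : Set (Fin n → ℂ)) : Prop :=
  ∃ I : Ideal (MvPolynomial (Fin n) ℂ), W = zeroLocus ℂ I

/-- A nonempty algebraic set that is not the union of two properly contained algebraic sets. -/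
def IsIrreducibleVariety {n : ℕ} (W : Set (Fin n → ℂ)) : Prop :=
  IsAlgebraicSet W ∧ W.Nonempty ∧
    ∀ W₁ W₂ : Set (Fin n → ℂ), IsAlgebraicSet W₁ → IsAlgebraicSet W₂ → W = W₁ ∪ W₂ →
      W = W₁ ∨ W = W₂

/-- The codimension of an algebraic set: the height of its vanishing ideal. -/
def codimension {n : ℕ} (W : Set (Fin n → ℂ)) : ℕ∞ := (vanishingIdeal ℂ W).height

/-- The affine Hilbert function: the dimension of the space of polynomials of total degree at most
`s` modulo those that vanish on `W`. -/
def affineHilbertFunction {n : ℕ} (W : Set (Fin n → ℂ)) (s : ℕ) : ℕ :=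
  Module.finrank ℂ ((restrictTotalDegree (Fin n) ℂ s).map
    (Ideal.Quotient.mkₐ ℂ (vanishingIdeal ℂ W)).toLinearMap)

/-- `W` has degree `d`: the affine Hilbert function of `W` agrees for large arguments with a
polynomial (the affine Hilbert polynomial, which is unique) of some degree `m`, whose leading
coefficient is `d / m!`. This is the degree of the projective closure of `W`. -/
def HasDegree {n : ℕ} (W : Set (Fin n → ℂ)) (d : ℕ) : Prop :=
  ∃ P : Polynomial ℚ, (∀ᶠ s : ℕ in atTop, (affineHilbertFunction W s : ℚ) = P.eval (s : ℚ)) ∧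
    P.leadingCoeff * (P.natDegree ! : ℚ) = d

end

/-! Let D be the matrix of squared distances of v₀, v₁, v₂, P. The variety W is where D kills a
nonzero vector c with coordinate sum zero. If no cᵢ vanishes, put eᵢⱼ = dᵢⱼcᵢcⱼ: then Dc = 0 says
that opposite edges have equal e and that the three resulting values sum to zero. After scaling, dᵢⱼ
= eᵢⱼcₖcₗ with {k, l} the complementary pair; this is `cocircularPoint`.

The geometry of W rests on one fact: modulo the four cubic minors the polynomial ring is free over
the polynomials in four linear forms, on six monomials of degrees 0, 1, 1, 2, 2, 2. Generation
(`restrictTotalDegree_le_fiberSpan`) is a degree-preserving reduction by the cubics. Independence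
(`eq_zero_of_sum_liftForms_mul_mem_ker`) holds even modulo the kernel of the parametrization,
because one fiber contains six points that the monomials separate. Hence this kernel is the ideal of
the minors, which is therefore prime, and the Hilbert function is a sum of six binomials with
leading term 6s⁴/4!. The codimension comes from chains of primes.

For the system, the first equation makes the Gram matrix of the vectors vᵢ - P singular, so its
adjugate is nnᵀ with n barycentric coordinates of P. Put S = ∑nᵢ and T = Xn₀ + Yn₁ + Zn₂. The circle
equations give A = κXn₀² and its analogues, and then T(S - κn₀n₁n₂) = 0. Since T/S is minus the
power of P with respect to the circumcircle, T = 0 is the cocircular case; the other factor gives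
the orthocenter. -/

noncomputable section

/-! ### The variety of cocircular quadruples -/

/-- The determinant of a `3 × 3` matrix, given by its rows. -/
def det3 {R : Type*} [CommRing R] (a b c d e f g h i : R) : R :=
  a * (e * i - f * h) - b * (d * i - f * g) + c * (d * h - e * g)

/-- The maximal minors of the matrix of differences of the rows of the matrix of squared
distances of a triangle and a point. They vanish simultaneously if and only if the matrix of squared
distances kills a nonzero vector with coordinate sum zero, which for four
distinct points of the plane means that the points are cocircular or collinear. -/
def cocircularMinor {R : Type*} [CommRing R] (A B C X Y Z : R) : Fin 4 → R :=
  ![det3 (-C) (A - B) (Y - X) (A - C) (-B) (Z - X) (Y - C) (Z - B) (-X),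
    det3 C (A - B) (Y - X) B (-B) (Z - X) X (Z - B) (-X),
    det3 C (-C) (Y - X) B (A - C) (Z - X) X (Y - C) (-X),
    det3 C (-C) (A - B) B (A - C) (-B) X (Y - C) (Z - B)]

theorem map_cocircularMinor {R S : Type*} [CommRing R] [CommRing S] (f : R →+* S)
    (A B C X Y Z : R) (k : Fin 4) :
    f (cocircularMinor A B C X Y Z k) =
      cocircularMinor (f A) (f B) (f C) (f X) (f Y) (f Z) k := by
  fin_cases k <;> simp [cocircularMinor, det3]

/-- The four cubic forms that generate the ideal of the variety of cocircular quadruples. -/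
def cocircularCubic : Fin 4 → MvPolynomial (Fin 6) ℂ :=
  cocircularMinor (X 0) (X 1) (X 2) (X 3) (X 4) (X 5)

/-- The ideal of the variety of cocircular quadruples. -/
def cocircularIdeal : Ideal (MvPolynomial (Fin 6) ℂ) :=
  Ideal.span (Set.range cocircularCubic)

theorem cocircularCubic_mem (k : Fin 4) : cocircularCubic k ∈ cocircularIdeal :=
  Ideal.subset_span ⟨k, rfl⟩

theorem mem_cocircularIdeal_of_eq {r : MvPolynomial (Fin 6) ℂ} (t : MvPolynomial (Fin 6) ℂ)
    (ht : t ∈ cocircularIdeal) (h : r = t) : r ∈ cocircularIdeal :=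
  h ▸ ht

/-! ### A finite projection -/

/-- The linear forms defining the projection to affine `4`-space. -/
def projectionForm : Fin 4 → MvPolynomial (Fin 6) ℂ :=
  ![X 5 - X 2, X 4 - X 2, X 3 + X 2 - X 0, 2 * X 1 - 3 * X 0 - 3 * X 2]

/-- Pullback of polynomials along the projection to affine `4`-space. -/
def liftForms : MvPolynomial (Fin 4) ℂ →ₐ[ℂ] MvPolynomial (Fin 6) ℂ :=
  aeval projectionForm

/-- Monomials generating the coordinate ring of the variety as a module over the coordinate ring
of affine `4`-space. -/
def fiberMonomial : Fin 6 → MvPolynomial (Fin 6) ℂ :=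
  ![1, X 0, X 2, X 0 ^ 2, X 0 * X 2, X 2 ^ 2]

/-- The degrees of the generating monomials. -/
def fiberDegree : Fin 6 → ℕ := ![0, 1, 1, 2, 2, 2]

/-- The polynomials that modulo the ideal of the variety are combinations of the generating
monomials with coefficients making up a total degree of at most `s`. -/
def fiberSpan (s : ℕ) : Submodule ℂ (MvPolynomial (Fin 6) ℂ) :=
  Submodule.span ℂ {r | ∃ g k, g.totalDegree + fiberDegree k ≤ s ∧
    r = liftForms g * fiberMonomial k} ⊔ cocircularIdeal.restrictScalars ℂ

theorem liftForms_mul_fiberMonomial_mem {g : MvPolynomial (Fin 4) ℂ} {k : Fin 6} {s : ℕ}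
    (h : g.totalDegree + fiberDegree k ≤ s) : liftForms g * fiberMonomial k ∈ fiberSpan s :=
  Submodule.mem_sup_left (Submodule.subset_span ⟨g, k, h, rfl⟩)

theorem mem_fiberSpan_of_mem_ideal {r : MvPolynomial (Fin 6) ℂ} (h : r ∈ cocircularIdeal)
    (s : ℕ) : r ∈ fiberSpan s :=
  Submodule.mem_sup_right h

theorem fiberSpan_mono {s t : ℕ} (h : s ≤ t) : fiberSpan s ≤ fiberSpan t :=
  sup_le_sup_right (Submodule.span_mono (by
    rintro _ ⟨g, k, hg, rfl⟩
    exact ⟨g, k, hg.trans h, rfl⟩)) _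

/-- The reductions come from solving a rational linear system; the factor 16 clears the
denominators. The degree bounds on `h` keep the reduction inside the same filtration step. -/
theorem liftForms_mul_mem_of_reduction {g : MvPolynomial (Fin 4) ℂ} {s : ℕ}
    (hg : g.totalDegree + 3 ≤ s) {c : MvPolynomial (Fin 6) ℂ}
    (h : Fin 6 → MvPolynomial (Fin 4) ℂ) (hd : ∀ k, (h k).totalDegree ≤ 3 - fiberDegree k)
    (hc : 16 * c - ∑ k, liftForms (h k) * fiberMonomial k ∈ cocircularIdeal) :
    liftForms g * c ∈ fiberSpan s := by
  have key : (16 : ℂ) • (liftForms g * c) ∈ fiberSpan s := by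
    have e : (16 : ℂ) • (liftForms g * c) =
        ∑ k, liftForms (g * h k) * fiberMonomial k +
          liftForms g * (16 * c - ∑ k, liftForms (h k) * fiberMonomial k) := by
      have : (16 : ℂ) • (liftForms g * c) = 16 * (liftForms g * c) := by
        rw [smul_eq_C_mul, map_ofNat]
      rw [this, mul_sub, Finset.mul_sum]
      simp only [map_mul, mul_assoc]
      ring
    rw [e]
    refine add_mem (Submodule.sum_mem _ fun k _ => liftForms_mul_fiberMonomial_mem ?_)
      (mem_fiberSpan_of_mem_ideal (Ideal.mul_mem_left _ _ hc) s)
    have := totalDegree_mul g (h k)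
    have := hd k
    have : fiberDegree k ≤ 2 := by fin_cases k <;> simp [fiberDegree]
    omega
  simpa using Submodule.smul_mem _ (16 : ℂ)⁻¹ key

section DegreeBounds

variable {σ : Type*} {p q : MvPolynomial σ ℂ} {m n : ℕ}

theorem totalDegree_add_le_of_le (hp : p.totalDegree ≤ n) (hq : q.totalDegree ≤ n) :
    (p + q).totalDegree ≤ n :=
  (totalDegree_add p q).trans (max_le hp hq)

theorem totalDegree_sub_le_of_le (hp : p.totalDegree ≤ n) (hq : q.totalDegree ≤ n) :
    (p - q).totalDegree ≤ n :=
  (totalDegree_sub p q).trans (max_le hp hq)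

theorem totalDegree_ofNat_mul_le_of_le (k : ℕ) [k.AtLeastTwo] (hp : p.totalDegree ≤ n) :
    ((OfNat.ofNat k : MvPolynomial σ ℂ) * p).totalDegree ≤ n := by
  rw [← map_ofNat C k, ← smul_eq_C_mul]
  exact (totalDegree_smul_le _ _).trans hp

theorem totalDegree_mul_X_le_of_le (i : σ) (hp : p.totalDegree ≤ n) :
    (p * X i).totalDegree ≤ n + 1 :=
  (totalDegree_mul _ _).trans (by rw [totalDegree_X]; omega)

theorem totalDegree_X_le (i : σ) : (X i : MvPolynomial σ ℂ).totalDegree ≤ 1 :=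
  (totalDegree_X i).le

end DegreeBounds

/-- Modulo the four projection forms, the cubics become four independent forms in `X 0` and `X 2`,
hence span `X 0 ^ 3`, `X 0 ^ 2 * X 2`, `X 0 * X 2 ^ 2`, `X 2 ^ 3`. Inverting that scalar matrix
gives this reduction and the next three; the list has the coefficients of 1, A, C, A², AC, C² in
this order. -/
theorem liftForms_mul_A_cubed_mem {g : MvPolynomial (Fin 4) ℂ} {s : ℕ}
    (hg : g.totalDegree + 3 ≤ s) :
    liftForms g * (X 0 * X 0 ^ 2) ∈ fiberSpan s := by
  refine liftForms_mul_mem_of_reduction hg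
    ![14 * (X 0 * X 1 * X 3) + 36 * (X 0 * X 2 * X 3) - 11 * (X 1 * X 1 * X 3) -
        39 * (X 1 * X 2 * X 3) - 3 * (X 1 * X 3 * X 3),
      136 * (X 0 * X 2) + 36 * (X 0 * X 3) + 78 * (X 2 * X 2) + 6 * (X 2 * X 3) -
          86 * (X 0 * X 1) - 33 * (X 1 * X 1) - 95 * (X 1 * X 2) - X 1 * X 3,
      64 * (X 0 * X 1) + 30 * (X 0 * X 2) + 16 * (X 1 * X 3) - 28 * (X 0 * X 0) -
          16 * (X 0 * X 3) - 33 * (X 1 * X 1) - 33 * (X 1 * X 2) - 3 * (X 2 * X 3) -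
              3 * (X 3 * X 3),
      136 * X 0 + 46 * X 1 + 62 * X 2 + 6 * X 3,
      33 * X 1 - 62 * X 0 - 91 * X 2 - 19 * X 3,
      13 * X 1 - 10 * X 0 - 3 * X 2 - 3 * X 3] ?_ ?_
  · intro k
    fin_cases k <;> dsimp [fiberDegree] <;>
      repeat' first
        | with_reducible exact totalDegree_X_le _
        | with_reducible apply totalDegree_add_le_of_le
        | with_reducible apply totalDegree_sub_le_of_le
        | with_reducible apply totalDegree_ofNat_mul_le_of_le
        | with_reducible apply totalDegree_mul_X_le_of_le
  · refine mem_cocircularIdeal_of_eq ((64) * cocircularCubic 0 + (36) * cocircularCubic 1 +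
      (-42) * cocircularCubic 2 + (-48) * cocircularCubic 3) ?_ ?_
    · repeat' first
        | exact Ideal.mul_mem_left _ _ (cocircularCubic_mem _)
        | apply Ideal.add_mem
    · simp only [Fin.sum_univ_six, liftForms, fiberMonomial, cocircularCubic, cocircularMinor, det3,
        projectionForm, Matrix.cons_val, map_add, map_sub, map_mul, map_ofNat, aeval_X]
      ring

theorem liftForms_mul_A_sq_mul_C_mem {g : MvPolynomial (Fin 4) ℂ} {s : ℕ}
    (hg : g.totalDegree + 3 ≤ s) :
    liftForms g * (X 2 * X 0 ^ 2) ∈ fiberSpan s := by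
  refine liftForms_mul_mem_of_reduction hg
    ![2 * (X 0 * X 1 * X 3) + 8 * (X 0 * X 2 * X 3) - X 1 * X 1 * X 3 - 9 * (X 1 * X 2 * X 3) -
        X 1 * X 3 * X 3,
      28 * (X 0 * X 2) + 8 * (X 0 * X 3) + 18 * (X 2 * X 2) + 2 * (X 2 * X 3) -
          18 * (X 0 * X 1) - 3 * (X 1 * X 1) - 25 * (X 1 * X 2) - 3 * (X 1 * X 3),
      8 * (X 0 * X 1) + 6 * (X 0 * X 2) + 4 * (X 1 * X 3) - 4 * (X 0 * X 0) - 4 * (X 0 * X 3) -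
          3 * (X 1 * X 1) - 7 * (X 1 * X 2) - X 2 * X 3 - X 3 * X 3,
      28 * X 0 + 2 * X 1 + 18 * X 2 + 2 * X 3,
      15 * X 1 - 10 * X 0 - 25 * X 2 - 9 * X 3,
      3 * X 1 - 2 * X 0 - X 2 - X 3] ?_ ?_
  · intro k
    fin_cases k <;> dsimp [fiberDegree] <;>
      repeat' first
        | with_reducible exact totalDegree_X_le _
        | with_reducible apply totalDegree_add_le_of_le
        | with_reducible apply totalDegree_sub_le_of_le
        | with_reducible apply totalDegree_ofNat_mul_le_of_le
        | with_reducible apply totalDegree_mul_X_le_of_le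
  · refine mem_cocircularIdeal_of_eq ((12) * cocircularCubic 0 + (8) * cocircularCubic 1 +
      (-10) * cocircularCubic 2 + (-12) * cocircularCubic 3) ?_ ?_
    · repeat' first
        | exact Ideal.mul_mem_left _ _ (cocircularCubic_mem _)
        | apply Ideal.add_mem
    · simp only [Fin.sum_univ_six, liftForms, fiberMonomial, cocircularCubic, cocircularMinor, det3,
        projectionForm, Matrix.cons_val, map_add, map_sub, map_mul, map_ofNat, aeval_X]
      ring

theorem liftForms_mul_A_mul_C_sq_mem {g : MvPolynomial (Fin 4) ℂ} {s : ℕ}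
    (hg : g.totalDegree + 3 ≤ s) :
    liftForms g * (X 0 * X 2 ^ 2) ∈ fiberSpan s := by
  refine liftForms_mul_mem_of_reduction hg
    ![2 * (X 0 * X 1 * X 3) - X 1 * X 1 * X 3 - X 1 * X 2 * X 3 - X 1 * X 3 * X 3,
      4 * (X 0 * X 2) + 2 * (X 2 * X 2) + 2 * (X 2 * X 3) - 2 * (X 0 * X 1) - 3 * (X 1 * X 1) -
          X 1 * X 2 - 3 * (X 1 * X 3),
      8 * (X 0 * X 1) + 4 * (X 0 * X 3) + X 1 * X 2 - 4 * (X 0 * X 0) - 2 * (X 0 * X 2) -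
          3 * (X 1 * X 1) - 4 * (X 1 * X 3) - X 2 * X 3 - X 3 * X 3,
      4 * X 0 + 2 * X 1 + 2 * X 2 + 2 * X 3,
      6 * X 0 + 7 * X 2 - 9 * X 1 - 9 * X 3,
      6 * X 0 - 5 * X 1 - X 2 - X 3] ?_ ?_
  · intro k
    fin_cases k <;> dsimp [fiberDegree] <;>
      repeat' first
        | with_reducible exact totalDegree_X_le _
        | with_reducible apply totalDegree_add_le_of_le
        | with_reducible apply totalDegree_sub_le_of_le
        | with_reducible apply totalDegree_ofNat_mul_le_of_le
        | with_reducible apply totalDegree_mul_X_le_of_le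
  · refine mem_cocircularIdeal_of_eq ((4) * cocircularCubic 0 + (-2) * cocircularCubic 2 +
      (-4) * cocircularCubic 3) ?_ ?_
    · repeat' first
        | exact Ideal.mul_mem_left _ _ (cocircularCubic_mem _)
        | apply Ideal.add_mem
    · simp only [Fin.sum_univ_six, liftForms, fiberMonomial, cocircularCubic, cocircularMinor, det3,
        projectionForm, Matrix.cons_val, map_add, map_sub, map_mul, map_ofNat, aeval_X]
      ring

theorem liftForms_mul_C_cubed_mem {g : MvPolynomial (Fin 4) ℂ} {s : ℕ}
    (hg : g.totalDegree + 3 ≤ s) :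
    liftForms g * (X 2 * X 2 ^ 2) ∈ fiberSpan s := by
  refine liftForms_mul_mem_of_reduction hg
    ![16 * (X 0 * X 2 * X 3) + 3 * (X 1 * X 1 * X 3) + 3 * (X 1 * X 2 * X 3) +
        3 * (X 1 * X 3 * X 3) - 22 * (X 0 * X 1 * X 3),
      4 * (X 0 * X 2) + 16 * (X 0 * X 3) + 9 * (X 1 * X 1) + 3 * (X 1 * X 2) + 9 * (X 1 * X 3) -
          10 * (X 0 * X 1) - 6 * (X 2 * X 2) - 6 * (X 2 * X 3),
      44 * (X 0 * X 0) + 54 * (X 0 * X 2) + 9 * (X 1 * X 1) + 12 * (X 1 * X 3) +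
          19 * (X 2 * X 3) + 3 * (X 3 * X 3) - 72 * (X 0 * X 1) - 44 * (X 0 * X 3) -
              35 * (X 1 * X 2),
      4 * X 0 - 6 * X 1 - 6 * X 2 - 6 * X 3,
      27 * X 1 + 27 * X 2 + 27 * X 3 - 2 * X 0,
      47 * X 1 + 19 * X 2 - 82 * X 0 - 13 * X 3] ?_ ?_
  · intro k
    fin_cases k <;> dsimp [fiberDegree] <;>
      repeat' first
        | with_reducible exact totalDegree_X_le _
        | with_reducible apply totalDegree_add_le_of_le
        | with_reducible apply totalDegree_sub_le_of_le
        | with_reducible apply totalDegree_ofNat_mul_le_of_le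
        | with_reducible apply totalDegree_mul_X_le_of_le
  · refine mem_cocircularIdeal_of_eq ((-28) * cocircularCubic 0 + (16) * cocircularCubic 1 +
      (22) * cocircularCubic 2 + (-4) * cocircularCubic 3) ?_ ?_
    · repeat' first
        | exact Ideal.mul_mem_left _ _ (cocircularCubic_mem _)
        | apply Ideal.add_mem
    · simp only [Fin.sum_univ_six, liftForms, fiberMonomial, cocircularCubic, cocircularMinor, det3,
        projectionForm, Matrix.cons_val, map_add, map_sub, map_mul, map_ofNat, aeval_X]
      ring

/-! ### Multiplication by a variable raises the filtration by one -/

theorem mul_mem_fiberSpan_succ {ℓ : MvPolynomial (Fin 6) ℂ}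
    (h : ∀ (g : MvPolynomial (Fin 4) ℂ) (k : Fin 6) (s : ℕ), g.totalDegree + fiberDegree k ≤ s →
      ℓ * (liftForms g * fiberMonomial k) ∈ fiberSpan (s + 1))
    {s : ℕ} {r : MvPolynomial (Fin 6) ℂ} (hr : r ∈ fiberSpan s) : ℓ * r ∈ fiberSpan (s + 1) := by
  have : fiberSpan s ≤ (fiberSpan (s + 1)).comap (LinearMap.mulLeft ℂ ℓ) := by
    refine sup_le (Submodule.span_le.2 ?_) fun r hr => ?_
    · rintro _ ⟨g, k, hg, rfl⟩
      exact h g k s hg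
    · exact mem_fiberSpan_of_mem_ideal (Ideal.mul_mem_left _ _ hr) _
  exact this hr

theorem projectionForm_mul_mem (j : Fin 4) {s : ℕ} {r : MvPolynomial (Fin 6) ℂ}
    (hr : r ∈ fiberSpan s) : projectionForm j * r ∈ fiberSpan (s + 1) := by
  refine mul_mem_fiberSpan_succ (fun g k s hg => ?_) hr
  have e : projectionForm j * (liftForms g * fiberMonomial k) =
      liftForms (g * X j) * fiberMonomial k := by
    rw [map_mul, liftForms, aeval_X]
    ring
  rw [e]
  refine liftForms_mul_fiberMonomial_mem ?_
  have := totalDegree_mul g (X j)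
  rw [totalDegree_X] at this
  omega

theorem X_zero_mul_mem {s : ℕ} {r : MvPolynomial (Fin 6) ℂ}
    (hr : r ∈ fiberSpan s) : X 0 * r ∈ fiberSpan (s + 1) := by
  refine mul_mem_fiberSpan_succ (fun g k s hg => ?_) hr
  rw [mul_left_comm]
  fin_cases k
  · replace hg : g.totalDegree + 0 ≤ s := hg
    convert liftForms_mul_fiberMonomial_mem (g := g) (k := 1) (s := s + 1) ?_ using 2
    · simp [fiberMonomial]
    · exact Nat.succ_le_succ hg
  · replace hg : g.totalDegree + 1 ≤ s := hg
    convert liftForms_mul_fiberMonomial_mem (g := g) (k := 3) (s := s + 1) ?_ using 2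
    · simp [fiberMonomial]; ring
    · exact Nat.succ_le_succ hg
  · replace hg : g.totalDegree + 1 ≤ s := hg
    convert liftForms_mul_fiberMonomial_mem (g := g) (k := 4) (s := s + 1) ?_ using 2
    · simp [fiberMonomial]
    · exact Nat.succ_le_succ hg
  · replace hg : g.totalDegree + 2 ≤ s := hg
    exact liftForms_mul_A_cubed_mem (by omega)
  · replace hg : g.totalDegree + 2 ≤ s := hg
    convert liftForms_mul_A_sq_mul_C_mem (g := g) (s := s + 1) ?_ using 2
    · simp [fiberMonomial]; ring
    · exact Nat.succ_le_succ hg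
  · replace hg : g.totalDegree + 2 ≤ s := hg
    exact liftForms_mul_A_mul_C_sq_mem (by omega)

theorem X_two_mul_mem {s : ℕ} {r : MvPolynomial (Fin 6) ℂ}
    (hr : r ∈ fiberSpan s) : X 2 * r ∈ fiberSpan (s + 1) := by
  refine mul_mem_fiberSpan_succ (fun g k s hg => ?_) hr
  rw [mul_left_comm]
  fin_cases k
  · replace hg : g.totalDegree + 0 ≤ s := hg
    convert liftForms_mul_fiberMonomial_mem (g := g) (k := 2) (s := s + 1) ?_ using 2
    · simp [fiberMonomial]
    · exact Nat.succ_le_succ hg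
  · replace hg : g.totalDegree + 1 ≤ s := hg
    convert liftForms_mul_fiberMonomial_mem (g := g) (k := 4) (s := s + 1) ?_ using 2
    · simp [fiberMonomial]; ring
    · exact Nat.succ_le_succ hg
  · replace hg : g.totalDegree + 1 ≤ s := hg
    convert liftForms_mul_fiberMonomial_mem (g := g) (k := 5) (s := s + 1) ?_ using 2
    · simp [fiberMonomial]; ring
    · exact Nat.succ_le_succ hg
  · replace hg : g.totalDegree + 2 ≤ s := hg
    exact liftForms_mul_A_sq_mul_C_mem (by omega)
  · replace hg : g.totalDegree + 2 ≤ s := hg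
    convert liftForms_mul_A_mul_C_sq_mem (g := g) (s := s + 1) ?_ using 2
    · simp [fiberMonomial]; ring
    · exact Nat.succ_le_succ hg
  · replace hg : g.totalDegree + 2 ≤ s := hg
    exact liftForms_mul_C_cubed_mem (by omega)

/-- The projection forms together with `X 0` and `X 2` span all linear forms. -/
theorem X_mul_mem (i : Fin 6) {s : ℕ} {r : MvPolynomial (Fin 6) ℂ}
    (hr : r ∈ fiberSpan s) : X i * r ∈ fiberSpan (s + 1) := by
  have h0 := X_zero_mul_mem hr
  have h2 := X_two_mul_mem hr
  have b := fun j => projectionForm_mul_mem j hr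
  fin_cases i
  · exact h0
  · have e : (X 1 : MvPolynomial (Fin 6) ℂ) * r =
        (2 : ℂ)⁻¹ • (projectionForm 3 * r + (3 : ℂ) • (X 0 * r) + (3 : ℂ) • (X 2 * r)) := by
      rw [eq_inv_smul_iff₀ two_ne_zero]
      simp only [smul_eq_C_mul, map_ofNat, projectionForm, Matrix.cons_val]
      ring
    change X 1 * r ∈ _
    rw [e]
    exact Submodule.smul_mem _ _ (add_mem (add_mem (b 3) (Submodule.smul_mem _ _ h0))
      (Submodule.smul_mem _ _ h2))
  · exact h2
  · have e : (X 3 : MvPolynomial (Fin 6) ℂ) * r = projectionForm 2 * r + X 0 * r - X 2 * r := by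
      simp only [projectionForm, Matrix.cons_val]
      ring
    change X 3 * r ∈ _
    rw [e]
    exact sub_mem (add_mem (b 2) h0) h2
  · have e : (X 4 : MvPolynomial (Fin 6) ℂ) * r = projectionForm 1 * r + X 2 * r := by
      simp only [projectionForm, Matrix.cons_val]
      ring
    change X 4 * r ∈ _
    rw [e]
    exact add_mem (b 1) h2
  · have e : (X 5 : MvPolynomial (Fin 6) ℂ) * r = projectionForm 0 * r + X 2 * r := by
      simp only [projectionForm, Matrix.cons_val]
      ring
    change X 5 * r ∈ _
    rw [e]
    exact add_mem (b 0) h2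

theorem restrictTotalDegree_le_fiberSpan (s : ℕ) :
    restrictTotalDegree (Fin 6) ℂ s ≤ fiberSpan s := by
  have key : ∀ (n : ℕ) (d : Fin 6 →₀ ℕ), d.degree = n →
      (monomial d 1 : MvPolynomial (Fin 6) ℂ) ∈ fiberSpan n := by
    intro n
    induction n with
    | zero =>
      intro d hd
      rw [Finsupp.degree_eq_zero_iff] at hd
      subst hd
      simpa [fiberMonomial] using
        liftForms_mul_fiberMonomial_mem (g := 1) (k := 0) (s := 0) (by simp [fiberDegree])
    | succ n ih =>
      intro d hd
      obtain ⟨i, hi⟩ : ∃ i, d i ≠ 0 := by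
        by_contra! h
        have : d = 0 := Finsupp.ext h
        simp [this] at hd
      have e : Finsupp.single i 1 + (d - Finsupp.single i 1) = d :=
        add_tsub_cancel_of_le (Finsupp.single_le_iff.2 (Nat.one_le_iff_ne_zero.2 hi))
      have hdeg : (d - Finsupp.single i 1).degree = n := by
        have := congrArg Finsupp.degree e
        rw [map_add, Finsupp.degree_single, hd] at this
        omega
      have := X_mul_mem i (ih _ hdeg)
      rwa [X, monomial_mul, e, one_mul] at this
  rw [restrictTotalDegree, restrictSupport_eq_span, Submodule.span_le]
  rintro _ ⟨d, hd, rfl⟩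
  exact fiberSpan_mono (show d.degree ≤ s from hd) (key _ d rfl)

/-! ### Independence of functions over a finite projection -/

theorem MvPolynomial.eq_zero_of_eventually_eval_eq_zero {r : ℕ} {f : MvPolynomial (Fin r) ℂ}
    {y₀ : Fin r → ℂ} (h : ∀ᶠ y in nhds y₀, eval y f = 0) : f = 0 := by
  obtain ⟨ε, hε, hball⟩ := Metric.eventually_nhds_iff_ball.1 h
  have : ∀ i, (Metric.ball (y₀ i) ε).Infinite :=
    fun i => infinite_of_mem_nhds (y₀ i) (Metric.ball_mem_nhds _ hε)
  refine MvPolynomial.funext_set (fun i => Metric.ball (y₀ i) ε) this fun x hx => ?_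
  rw [map_zero]
  refine hball x ?_
  rwa [ball_pi _ hε]

/-- Functions are linearly independent over the polynomials in `β` if some fiber of `β` contains
points at which `β` is open and which the functions separate linearly. -/
theorem eq_zero_of_forall_sum_eval_mul_eq_zero {n r N : ℕ} {β : (Fin n → ℂ) → Fin r → ℂ}
    {μ : Fin N → (Fin n → ℂ) → ℂ} (hμ : ∀ k, Continuous (μ k)) {a : Fin N → Fin n → ℂ}
    {y₀ : Fin r → ℂ} (hβ : ∀ j, nhds y₀ ≤ map β (nhds (a j)))
    (hdet : (Matrix.of fun j k => μ k (a j)).det ≠ 0) {f : Fin N → MvPolynomial (Fin r) ℂ}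
    (hf : ∀ v, ∑ k, eval (β v) (f k) * μ k v = 0) : f = 0 := by
  have hcont : Continuous fun b : Fin N → Fin n → ℂ =>
      (Matrix.of fun j k => μ k (b j)).det :=
    Continuous.matrix_det (continuous_matrix fun j k => (hμ k).comp (continuous_apply j))
  -- Nonvanishing of the determinant is an open condition, so it persists when each point moves in
  -- its own neighborhood `t j`; the images of these neighborhoods all contain every `y` near `y₀`.
  have hev : {b : Fin N → Fin n → ℂ | (Matrix.of fun j k => μ k (b j)).det ≠ 0} ∈ nhds a :=
    hcont.continuousAt.eventually_ne hdet
  rw [nhds_pi, Filter.mem_pi'] at hev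
  obtain ⟨I, t, ht, hsub⟩ := hev
  have himg : ∀ᶠ y in nhds y₀, ∀ j, y ∈ β '' t j :=
    eventually_all.2 fun j => hβ j (image_mem_map (ht j))
  have hzero : ∀ᶠ y in nhds y₀, ∀ k, eval y (f k) = 0 := by
    filter_upwards [himg] with y hy
    choose b hb hby using hy
    have hb' : (Matrix.of fun j k => μ k (b j)).det ≠ 0 := hsub fun j _ => hb j
    have hvec : (Matrix.of fun j k => μ k (b j)).mulVec (fun k => eval y (f k)) = 0 := by
      ext j
      have := hf (b j)
      rw [hby j] at this
      simpa [Matrix.mulVec, dotProduct, mul_comm] using this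
    exact fun k => congrFun (Matrix.eq_zero_of_mulVec_eq_zero hb' hvec) k
  exact funext fun k =>
    MvPolynomial.eq_zero_of_eventually_eval_eq_zero (hzero.mono fun y hy => hy k)

/-! ### A parametrization of the variety -/

/-- A parametrization of the variety of cocircular quadruples. -/
def cocircularPoint {R : Type*} [CommRing R] (v : Fin 5 → R) : Fin 6 → R :=
  ![(-v 3 - v 4) * (-v 0 - v 1 - v 2) * v 2, v 4 * v 0 * v 2, v 3 * v 1 * v 2,
    (-v 3 - v 4) * v 0 * v 1, v 4 * (-v 0 - v 1 - v 2) * v 1, v 3 * (-v 0 - v 1 - v 2) * v 0]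

/-- Pullback of polynomials along the parametrization. -/
def cocircularPullback : MvPolynomial (Fin 6) ℂ →ₐ[ℂ] MvPolynomial (Fin 5) ℂ :=
  aeval (cocircularPoint X)

theorem eval_cocircularPullback (v : Fin 5 → ℂ) (f : MvPolynomial (Fin 6) ℂ) :
    eval v (cocircularPullback f) = eval (cocircularPoint v) f := by
  have : (aeval v : MvPolynomial (Fin 5) ℂ →ₐ[ℂ] ℂ).comp cocircularPullback =
      aeval (cocircularPoint v) := by
    ext i
    fin_cases i <;> simp [cocircularPullback, cocircularPoint]
  simpa [aeval_eq_eval] using congrArg (fun g => g f) this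

theorem cocircularIdeal_le_ker : cocircularIdeal ≤ RingHom.ker cocircularPullback := by
  refine Ideal.span_le.2 ?_
  rintro _ ⟨k, rfl⟩
  change cocircularPullback (cocircularCubic k) = 0
  refine (map_cocircularMinor cocircularPullback.toRingHom _ _ _ _ _ _ k).trans ?_
  fin_cases k <;>
    simp only [cocircularPullback, cocircularPoint, cocircularMinor, det3,
    AlgHom.toRingHom_eq_coe, RingHom.coe_coe, aeval_X,
      Matrix.cons_val, Fin.zero_eta, Fin.mk_one, Fin.reduceFinMk] <;>
    ring

/-- The composition of the parametrization with the projection to affine `4`-space. -/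
def projectedPoint (v : Fin 5 → ℂ) : Fin 4 → ℂ :=
  ![v 3 * (-v 0 - v 1 - v 2) * v 0 - v 3 * v 1 * v 2,
    v 4 * (-v 0 - v 1 - v 2) * v 1 - v 3 * v 1 * v 2,
    (-v 3 - v 4) * v 0 * v 1 + v 3 * v 1 * v 2 - (-v 3 - v 4) * (-v 0 - v 1 - v 2) * v 2,
    2 * (v 4 * v 0 * v 2) - 3 * ((-v 3 - v 4) * (-v 0 - v 1 - v 2) * v 2) -
      3 * (v 3 * v 1 * v 2)]

theorem eval_liftForms (v : Fin 5 → ℂ) (g : MvPolynomial (Fin 4) ℂ) :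
    eval (cocircularPoint v) (liftForms g) = eval (projectedPoint v) g := by
  have : (aeval (cocircularPoint v) : MvPolynomial (Fin 6) ℂ →ₐ[ℂ] ℂ).comp liftForms =
      aeval (projectedPoint v) := by
    ext i
    fin_cases i <;> simp [liftForms, projectionForm, cocircularPoint, projectedPoint]
  simpa [aeval_eq_eval] using congrArg (fun g' => g' g) this

/-- The derivative of `projectedPoint`. -/
def projectedPointDeriv (a h : Fin 5 → ℂ) : Fin 4 → ℂ :=
  ![h 3 * (-a 0 - a 1 - a 2) * a 0 + a 3 * (-h 0 - h 1 - h 2) * a 0 +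
      a 3 * (-a 0 - a 1 - a 2) * h 0 -
      (h 3 * a 1 * a 2 + a 3 * h 1 * a 2 + a 3 * a 1 * h 2),
    h 4 * (-a 0 - a 1 - a 2) * a 1 + a 4 * (-h 0 - h 1 - h 2) * a 1 +
      a 4 * (-a 0 - a 1 - a 2) * h 1 -
      (h 3 * a 1 * a 2 + a 3 * h 1 * a 2 + a 3 * a 1 * h 2),
    (-h 3 - h 4) * a 0 * a 1 + (-a 3 - a 4) * h 0 * a 1 + (-a 3 - a 4) * a 0 * h 1 +
      (h 3 * a 1 * a 2 + a 3 * h 1 * a 2 + a 3 * a 1 * h 2) -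
      ((-h 3 - h 4) * (-a 0 - a 1 - a 2) * a 2 + (-a 3 - a 4) * (-h 0 - h 1 - h 2) * a 2 +
        (-a 3 - a 4) * (-a 0 - a 1 - a 2) * h 2),
    2 * (h 4 * a 0 * a 2 + a 4 * h 0 * a 2 + a 4 * a 0 * h 2) -
      3 * ((-h 3 - h 4) * (-a 0 - a 1 - a 2) * a 2 +
        (-a 3 - a 4) * (-h 0 - h 1 - h 2) * a 2 +
        (-a 3 - a 4) * (-a 0 - a 1 - a 2) * h 2) -
      3 * (h 3 * a 1 * a 2 + a 3 * h 1 * a 2 + a 3 * a 1 * h 2)]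

theorem exists_hasStrictFDerivAt_projectedPoint (a : Fin 5 → ℂ) :
    ∃ L : (Fin 5 → ℂ) →L[ℂ] (Fin 4 → ℂ), HasStrictFDerivAt projectedPoint L a ∧
      ∀ h, L h = projectedPointDeriv a h := by
  have h (i : Fin 5) : HasStrictFDerivAt (fun v : Fin 5 → ℂ => v i)
      (ContinuousLinearMap.proj (R := ℂ) i) a := hasStrictFDerivAt_apply i a
  have hu := ((h 0).neg.sub (h 1)).sub (h 2)
  have hs := (h 3).neg.sub (h 4)
  have hC := ((h 3).mul (h 1)).mul (h 2)
  have hA := (hs.mul hu).mul (h 2)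
  have key (i : Fin 4) : ∃ l : (Fin 5 → ℂ) →L[ℂ] ℂ,
      HasStrictFDerivAt (fun v => projectedPoint v i) l a ∧
        ∀ h, l h = projectedPointDeriv a h i := by
    fin_cases i
    · exact ⟨_, (((h 3).mul hu).mul (h 0)).sub hC, fun w => by
        simp [projectedPointDeriv]; ring⟩
    · exact ⟨_, (((h 4).mul hu).mul (h 1)).sub hC, fun w => by
        simp [projectedPointDeriv]; ring⟩
    · exact ⟨_, (((hs.mul (h 0)).mul (h 1)).add hC).sub hA, fun w => by
        simp [projectedPointDeriv]; ring⟩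
    · exact ⟨_, (((((h 4).mul (h 0)).mul (h 2)).const_mul 2).sub (hA.const_mul 3)).sub
        (hC.const_mul 3), fun w => by
        simp [projectedPointDeriv]; ring⟩
  choose l hl hlw using key
  exact ⟨ContinuousLinearMap.pi l, hasStrictFDerivAt_pi'.2 hl, fun w => funext fun i => hlw i w⟩

/-- Parameters of six points in one fiber of the projection. -/
def fiberParameter : Fin 6 → Fin 5 → ℂ :=
  ![![-1, -1, 1, -1, 1],
    ![-2, 2, 1, -1, 2],
    ![2, -2, 1, -2, 1],
    ![-3/2, 2, 1, 0, 2/3],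
    ![-1, -2, 1, -1/2, 1/4],
    ![-6/5, -2/5, 1, 0, 25/3]]

theorem projectedPoint_fiberParameter (j : Fin 6) :
    projectedPoint (fiberParameter j) = ![0, -2, 1, -5] := by
  ext i
  fin_cases j <;> fin_cases i <;> simp [projectedPoint, fiberParameter] <;> norm_num

/-- A right inverse of the derivative of `projectedPoint` at each of the six parameters. -/
def fiberDirection (t : Fin 4 → ℂ) : Fin 6 → Fin 5 → ℂ :=
  ![![5/4 * t 0 + 3/2 * t 1 + 15/2 * t 2 + t 3, 1/4 * t 0 + 1/2 * t 1 + 1/2 * t 2,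
    -7/4 * t 0 - 3/2 * t 1 - 15/2 * t 2 - t 3, -2 * t 0 - 2 * t 1 - 9 * t 2 - t 3, 0],
    ![-95/16 * t 0 + 19/16 * t 1 - 1/32 * t 2 - 9/32 * t 3,
      79/16 * t 0 - 19/16 * t 1 + 1/32 * t 2 + 9/32 * t 3,
      55/32 * t 0 - 11/32 * t 1 - 7/64 * t 2 + 1/64 * t 3,
      -35/16 * t 0 + 7/16 * t 1 + 3/32 * t 2 - 5/32 * t 3, 0],
    ![1/3 * t 0 + 5/8 * t 1 + 1/16 * t 2 - 7/16 * t 3,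
      -1/6 * t 0 - 5/8 * t 1 - 1/16 * t 2 + 7/16 * t 3,
      1/12 * t 0 + 1/16 * t 1 + 5/32 * t 2 - 3/32 * t 3, 7/8 * t 1 + 3/16 * t 2 - 5/16 * t 3, 0],
    ![41/4 * t 0 - 17/96 * t 1 - 41/96 * t 2 + 13/96 * t 3,
      -19/3 * t 0 - 29/72 * t 1 + 19/72 * t 2 + 1/72 * t 3,
      -31/6 * t 0 + 19/144 * t 1 - 5/144 * t 2 - 23/144 * t 3, 4 * t 0, 0],
    ![-7/12 * t 0 - 3/2 * t 1 - 27/2 * t 2 - 2 * t 3, 1/6 * t 0 + t 1 + t 2,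
      -1/12 * t 0 + 3/2 * t 1 + 27/2 * t 2 + 2 * t 3, 1/2 * t 1 + 6 * t 2 + t 3, 0],
    ![5/8 * t 0 + 2/15 * t 1 - 1/6 * t 2 + 1/30 * t 3,
      17/120 * t 0 + 11/90 * t 1 + 13/180 * t 2 + 1/180 * t 3,
      -29/48 * t 0 - 5/36 * t 1 - 1/72 * t 2 - 17/360 * t 3, -25/8 * t 0, 0]]

set_option maxHeartbeats 1000000 in
theorem projectedPointDeriv_fiberDirection (t : Fin 4 → ℂ) (j : Fin 6) :
    projectedPointDeriv (fiberParameter j) (fiberDirection t j) = t := by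
  ext i
  fin_cases j <;> fin_cases i <;>
    simp [projectedPointDeriv, fiberParameter, fiberDirection] <;> ring

/-- A strictly differentiable map with surjective derivative is open at the point. -/
theorem nhds_le_map_fiberParameter (j : Fin 6) :
    nhds ![0, -2, 1, -5] ≤ map projectedPoint (nhds (fiberParameter j)) := by
  obtain ⟨L, hL, hLw⟩ := exists_hasStrictFDerivAt_projectedPoint (fiberParameter j)
  rw [← projectedPoint_fiberParameter j, hL.map_nhds_eq_of_surj]
  exact LinearMap.range_eq_top.2 fun t =>
    ⟨fiberDirection t j, (hLw _).trans (projectedPointDeriv_fiberDirection t j)⟩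

/-- Equivalently, the points (A, C) = (0, 1), (1, -2), (-1, 4), (1, 0), (1/2, 1), (-5, 0) of the
fiber impose independent conditions on polynomials of degree at most two. -/
theorem det_fiberMonomial_fiberParameter_ne_zero :
    (Matrix.of fun j k => eval (cocircularPoint (fiberParameter j)) (fiberMonomial k)).det ≠ 0 := by
  have hV : (Matrix.of fun j k => eval (cocircularPoint (fiberParameter j)) (fiberMonomial k)) =
      !![1, 0, 1, 0, 0, 1;
      1, 1, -2, 1, -2, 4;
      1, -1, 4, 1, -4, 16;
      1, 1, 0, 1, 0, 0;
      1, 1/2, 1, 1/4, 1/2, 1;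
      1, -5, 0, 25, 0, 0] := by
    ext j k
    fin_cases j <;> fin_cases k <;>
      simp [fiberMonomial, fiberParameter, cocircularPoint] <;> norm_num
  rw [hV]
  refine Matrix.det_ne_zero_of_right_inverse (B :=
    !![5/4, 5/16, -5/32, -5/12, 0, 1/96;
      -1, -1/4, 1/8, 7/6, 0, -1/24;
      1/8, -15/32, 29/192, 7/8, -2/3, -1/64;
      -1/4, -1/16, 1/32, 1/4, 0, 1/32;
      -7/8, 9/32, -9/64, -31/24, 2, 5/192;
      -3/8, 5/32, 1/192, -11/24, 2/3, 1/192]) ?_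
  ext j k
  fin_cases j <;> fin_cases k <;> simp [Matrix.mul_apply, Fin.sum_univ_six] <;> norm_num

theorem eq_zero_of_sum_liftForms_mul_mem_ker {f : Fin 6 → MvPolynomial (Fin 4) ℂ}
    (hf : ∑ k, liftForms (f k) * fiberMonomial k ∈ RingHom.ker cocircularPullback) : f = 0 := by
  refine eq_zero_of_forall_sum_eval_mul_eq_zero (β := projectedPoint)
    (μ := fun k v => eval (cocircularPoint v) (fiberMonomial k)) (fun k => ?_)
    nhds_le_map_fiberParameter det_fiberMonomial_fiberParameter_ne_zero fun v => ?_
  · simp_rw [← eval_cocircularPullback]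
    exact continuous_eval _
  · have := congrArg (eval v) (RingHom.mem_ker.1 hf)
    rw [eval_cocircularPullback, map_zero, map_sum] at this
    simpa only [map_mul, eval_liftForms] using this

/-! ### The ideal is prime -/

/-- The polynomials in four variables of total degree at most `s - e`; zero only if `s < e`. -/
def coefficientSpace (e s : ℕ) : Submodule ℂ (MvPolynomial (Fin 4) ℂ) :=
  restrictSupport ℂ {n | n.degree + e ≤ s}

theorem mem_coefficientSpace {e s : ℕ} {g : MvPolynomial (Fin 4) ℂ} :
    g ∈ coefficientSpace e s ↔ g = 0 ∨ g.totalDegree + e ≤ s := by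
  rw [coefficientSpace, mem_restrictSupport_iff]
  constructor
  · refine fun h => or_iff_not_imp_left.2 fun hg => ?_
    obtain ⟨d, hd⟩ := support_nonempty.2 hg
    have hes : e ≤ s := (Nat.le_add_left _ _).trans (h hd)
    have : g.totalDegree ≤ s - e := Finset.sup_le fun n hn => Nat.le_sub_of_add_le (h hn)
    omega
  · rintro (rfl | h) n hn
    · simp at hn
    · exact (Nat.add_le_add_right (le_totalDegree (Finset.mem_coe.1 hn)) e).trans h

theorem exists_sum_of_mem_fiberSpan {s : ℕ} {r : MvPolynomial (Fin 6) ℂ} (hr : r ∈ fiberSpan s) :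
    ∃ f : Fin 6 → MvPolynomial (Fin 4) ℂ, (∀ k, f k ∈ coefficientSpace (fiberDegree k) s) ∧
      r - ∑ k, liftForms (f k) * fiberMonomial k ∈ cocircularIdeal := by
  obtain ⟨a, ha, b, hb, rfl⟩ := Submodule.mem_sup.1 hr
  suffices h : ∃ f : Fin 6 → MvPolynomial (Fin 4) ℂ,
      (∀ k, f k ∈ coefficientSpace (fiberDegree k) s) ∧
        ∑ k, liftForms (f k) * fiberMonomial k = a by
    obtain ⟨f, hf, rfl⟩ := h
    exact ⟨f, hf, by simpa using hb⟩
  induction ha using Submodule.span_induction with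
  | mem x hx =>
    obtain ⟨g, k, hg, rfl⟩ := hx
    refine ⟨Pi.single k g, fun l => ?_, ?_⟩
    · rcases eq_or_ne l k with rfl | hl
      · simpa using mem_coefficientSpace.2 (Or.inr hg)
      · simp [hl]
    · rw [Finset.sum_eq_single k (fun l _ hl => by simp [hl]) (by simp), Pi.single_eq_same]
  | zero => exact ⟨0, fun k => Submodule.zero_mem _, by simp⟩
  | add x y hx hy ihx ihy =>
    obtain ⟨f, hf, rfl⟩ := ihx (Submodule.mem_sup.2 ⟨x, hx, b, hb, rfl⟩)
    obtain ⟨g, hg, rfl⟩ := ihy (Submodule.mem_sup.2 ⟨y, hy, b, hb, rfl⟩)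
    exact ⟨f + g, fun k => add_mem (hf k) (hg k), by simp [add_mul, Finset.sum_add_distrib]⟩
  | smul c x hx ih =>
    obtain ⟨f, hf, rfl⟩ := ih (Submodule.mem_sup.2 ⟨x, hx, b, hb, rfl⟩)
    exact ⟨c • f, fun k => Submodule.smul_mem _ c (hf k), by simp [Finset.smul_sum]⟩

/-- Reduce an element of the kernel to a combination of the six monomials; independence modulo the
kernel forces all coefficients to be zero, so the element lies in the ideal. -/
theorem ker_cocircularPullback : RingHom.ker cocircularPullback = cocircularIdeal := by
  refine le_antisymm (fun r hr => ?_) cocircularIdeal_le_ker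
  obtain ⟨f, -, hf⟩ := exists_sum_of_mem_fiberSpan
    (restrictTotalDegree_le_fiberSpan r.totalDegree ((mem_restrictTotalDegree _ _ _).2 le_rfl))
  have hf0 : f = 0 := eq_zero_of_sum_liftForms_mul_mem_ker <| by
    simpa using sub_mem hr (cocircularIdeal_le_ker hf)
  simpa [hf0] using hf

instance isPrime_cocircularIdeal : cocircularIdeal.IsPrime :=
  ker_cocircularPullback ▸ RingHom.ker_isPrime _

/-! ### The Hilbert function -/

theorem finrank_coefficientSpace {e s : ℕ} (h : e ≤ s) :
    Module.finrank ℂ (coefficientSpace e s) = (s - e + 4).choose 4 := by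
  classical
  rw [coefficientSpace, Module.finrank_eq_nat_card_basis (basisRestrictSupport ℂ _)]
  have hset : {n : Fin 4 →₀ ℕ | n.degree + e ≤ s} =
      ↑((Finset.range (s - e + 1)).biUnion fun i =>
        Finset.finsuppAntidiag (Finset.univ : Finset (Fin 4)) i) := by
    ext n
    simp only [Set.mem_ofPred_eq, Finset.coe_biUnion, Set.mem_iUnion, Finset.mem_coe,
      Finset.mem_range, Finset.mem_finsuppAntidiag, Finset.subset_univ, and_true, exists_prop,
      Finsupp.degree_eq_sum, exists_eq_right']
    have : Finset.univ.sum ⇑n = ∑ i, n i := rfl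
    omega
  rw [hset, Nat.card_coe_set_eq, Set.ncard_coe_finset, Finset.card_biUnion]
  · simp only [Finset.card_finsuppAntidiag_nat_eq_choose, Finset.card_univ, Fintype.card_fin]
    -- Hockey-stick identity: sum the numbers of monomials of each exact degree.
    rw [← Nat.sum_range_add_choose]
    refine Finset.sum_congr rfl fun i _ => ?_
    rw [show 4 + i - 1 = i + 3 by omega, ← Nat.choose_symm_add]
  · intro i _ j _ hij
    refine Finset.disjoint_left.2 fun n hi hj => hij ?_
    rw [Finset.mem_finsuppAntidiag] at hi hj
    exact hi.1.symm.trans hj.1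

theorem totalDegree_liftForms_le (g : MvPolynomial (Fin 4) ℂ) :
    (liftForms g).totalDegree ≤ g.totalDegree := by
  have hl (i : Fin 4) : (projectionForm i).totalDegree ≤ 1 := by
    fin_cases i <;> dsimp [projectionForm] <;> repeat' first
        | with_reducible exact totalDegree_X_le _
        | with_reducible apply totalDegree_add_le_of_le
        | with_reducible apply totalDegree_sub_le_of_le
        | with_reducible apply totalDegree_ofNat_mul_le_of_le
  rw [liftForms, aeval_def, eval₂_eq']
  refine totalDegree_finsetSum_le fun d hd => ?_
  rw [algebraMap_eq, ← smul_eq_C_mul]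
  refine (totalDegree_smul_le _ _).trans ((totalDegree_finsetProd _ _).trans ?_)
  refine le_trans (Finset.sum_le_sum fun i _ => ?_)
    ((Finsupp.degree_eq_sum d).symm.le.trans (le_totalDegree hd))
  exact (totalDegree_pow _ _).trans ((Nat.mul_le_mul_left _ (hl i)).trans (mul_one _).le)

theorem totalDegree_fiberMonomial_le (k : Fin 6) :
    (fiberMonomial k).totalDegree ≤ fiberDegree k := by
  fin_cases k <;> simp [fiberMonomial, fiberDegree, totalDegree_X_pow]
  exact (totalDegree_mul _ _).trans (by simp)

/-- Combinations of the generating monomials as elements of the coordinate ring. -/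
def fiberCombination (s : ℕ) : (∀ k, coefficientSpace (fiberDegree k) s) →ₗ[ℂ]
    MvPolynomial (Fin 6) ℂ ⧸ cocircularIdeal :=
  (Ideal.Quotient.mkₐ ℂ cocircularIdeal).toLinearMap ∘ₗ
    ∑ k, LinearMap.mulRight ℂ (fiberMonomial k) ∘ₗ liftForms.toLinearMap ∘ₗ
      (coefficientSpace (fiberDegree k) s).subtype ∘ₗ LinearMap.proj k

theorem fiberCombination_apply (s : ℕ) (f : ∀ k, coefficientSpace (fiberDegree k) s) :
    fiberCombination s f =
      Ideal.Quotient.mk cocircularIdeal (∑ k, liftForms (f k) * fiberMonomial k) := by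
  simp [fiberCombination]

theorem fiberCombination_injective (s : ℕ) : Function.Injective (fiberCombination s) := by
  refine (injective_iff_map_eq_zero _).2 fun f hf => ?_
  rw [fiberCombination_apply, Ideal.Quotient.eq_zero_iff_mem] at hf
  have := eq_zero_of_sum_liftForms_mul_mem_ker (f := fun k => f k) (cocircularIdeal_le_ker hf)
  exact funext fun k => Subtype.ext (congrFun this k)

theorem range_fiberCombination (s : ℕ) : LinearMap.range (fiberCombination s) =
    (restrictTotalDegree (Fin 6) ℂ s).map
      (Ideal.Quotient.mkₐ ℂ cocircularIdeal).toLinearMap := by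
  ext x
  constructor
  · rintro ⟨f, rfl⟩
    rw [fiberCombination_apply]
    refine Submodule.mem_map_of_mem (f := (Ideal.Quotient.mkₐ ℂ cocircularIdeal).toLinearMap)
      (Submodule.sum_mem _ fun k _ => ?_)
    rw [mem_restrictTotalDegree]
    rcases mem_coefficientSpace.1 (f k).2 with h | h
    · simp [h]
    · have h1 := totalDegree_mul (liftForms (f k)) (fiberMonomial k)
      have h2 := totalDegree_liftForms_le (f k)
      have h3 := totalDegree_fiberMonomial_le k
      omega
  · rintro ⟨r, hr, rfl⟩
    obtain ⟨f, hf, hfr⟩ := exists_sum_of_mem_fiberSpan (restrictTotalDegree_le_fiberSpan s hr)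
    refine ⟨fun k => ⟨f k, hf k⟩, ?_⟩
    rw [fiberCombination_apply]
    exact (Ideal.Quotient.eq.2 hfr).symm

/-- The variety of cocircular quadruples, in terms of squared distances. -/
def cocircularVariety : Set (Fin 6 → ℂ) := zeroLocus ℂ cocircularIdeal

theorem vanishingIdeal_cocircularVariety :
    vanishingIdeal ℂ cocircularVariety = cocircularIdeal :=
  IsPrime.vanishingIdeal_zeroLocus cocircularIdeal

theorem affineHilbertFunction_eq {n : ℕ} {W : Set (Fin n → ℂ)} {I : Ideal (MvPolynomial (Fin n) ℂ)}
    (h : vanishingIdeal ℂ W = I) (s : ℕ) :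
    affineHilbertFunction W s = Module.finrank ℂ
      ((restrictTotalDegree (Fin n) ℂ s).map (Ideal.Quotient.mkₐ ℂ I).toLinearMap) := by
  subst h
  rfl

theorem cast_choose_four (n : ℕ) :
    ((n + 4).choose 4 : ℚ) = (n + 4) * (n + 3) * (n + 2) * (n + 1) / 24 := by
  have h := Nat.descFactorial_eq_factorial_mul_choose (n + 4) 4
  simp only [Nat.descFactorial, Nat.factorial] at h
  have h' := congrArg (Nat.cast : ℕ → ℚ) h
  simp at h'
  linarith

theorem affineHilbertFunction_cocircularVariety {s : ℕ} (hs : 2 ≤ s) :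
    affineHilbertFunction cocircularVariety s =
      (s + 4).choose 4 + 2 * (s + 3).choose 4 + 3 * (s + 2).choose 4 := by
  rw [affineHilbertFunction_eq vanishingIdeal_cocircularVariety, ← range_fiberCombination,
    LinearMap.finrank_range_of_inj (fiberCombination_injective s)]
  have hle (k : Fin 6) : fiberDegree k ≤ s := by
    fin_cases k <;> simp [fiberDegree] <;> omega
  have (k : Fin 6) : Module.Finite ℂ (coefficientSpace (fiberDegree k) s) := by
    refine Module.finite_of_finrank_pos ?_
    rw [finrank_coefficientSpace (hle k)]
    exact Nat.choose_pos (by omega)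
  rw [Module.finrank_pi_fintype]
  simp only [finrank_coefficientSpace (hle _), Fin.sum_univ_six]
  simp only [fiberDegree, Matrix.cons_val]
  rw [show s - 0 + 4 = s + 4 by omega, show s - 1 + 4 = s + 3 by omega,
    show s - 2 + 4 = s + 2 by omega]
  ring

theorem hasDegree_cocircularVariety : HasDegree cocircularVariety 6 := by
  -- The expansion of the three binomial terms of the Hilbert function as a polynomial in `s`.
  let P : Polynomial ℚ := .C (1 / 4) * .X ^ 4 + .C (7 / 6) * .X ^ 3 + .C (9 / 4) * .X ^ 2 +
    .C (7 / 3) * .X + .C 1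
  have hdeg : P.natDegree = 4 := by
    simp only [P]
    compute_degree!
  have hlead : P.leadingCoeff = 1 / 4 := by
    rw [Polynomial.leadingCoeff, hdeg]
    simp only [P]
    compute_degree!
  refine ⟨P, ?_, by rw [hdeg, hlead]; norm_num [Nat.factorial]⟩
  filter_upwards [eventually_ge_atTop 2] with s hs
  obtain ⟨t, rfl⟩ := Nat.exists_eq_add_of_le' hs
  rw [affineHilbertFunction_cocircularVariety hs]
  push_cast
  rw [show t + 2 + 4 = (t + 2) + 4 by ring, show t + 2 + 3 = (t + 1) + 4 by ring,
    show t + 2 + 2 = t + 4 by ring, cast_choose_four, cast_choose_four, cast_choose_four]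
  simp only [P, Polynomial.eval_add, Polynomial.eval_mul, Polynomial.eval_C, Polynomial.eval_pow,
    Polynomial.eval_X]
  push_cast
  ring

/-! ### Irreducibility and codimension -/

/-- By the Nullstellensatz a prime ideal is the vanishing ideal of its zero locus. If neither ideal
of a decomposition lay in it, two elements outside it would have a product vanishing on the whole
locus. -/
theorem isIrreducibleVariety_zeroLocus {n : ℕ} (I : Ideal (MvPolynomial (Fin n) ℂ))
    [hI : I.IsPrime] : IsIrreducibleVariety (zeroLocus ℂ I) := by
  refine ⟨⟨I, rfl⟩, ?_, ?_⟩
  · rw [Set.nonempty_iff_ne_empty]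
    intro h
    have := IsPrime.vanishingIdeal_zeroLocus (K := ℂ) I
    rw [h, vanishingIdeal_empty] at this
    exact hI.ne_top this.symm
  · rintro _ _ ⟨I₁, rfl⟩ ⟨I₂, rfl⟩ h
    by_cases h₁ : I₁ ≤ I
    · exact Or.inl ((zeroLocus_anti_mono h₁).antisymm (h ▸ Set.subset_union_left))
    by_cases h₂ : I₂ ≤ I
    · exact Or.inr ((zeroLocus_anti_mono h₂).antisymm (h ▸ Set.subset_union_right))
    exfalso
    obtain ⟨f, hf, hfI⟩ := SetLike.not_le_iff_exists.1 h₁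
    obtain ⟨g, hg, hgI⟩ := SetLike.not_le_iff_exists.1 h₂
    have hfg : f * g ∈ vanishingIdeal ℂ (zeroLocus ℂ I) := by
      rw [mem_vanishingIdeal_iff]
      intro x hx
      rw [h] at hx
      rcases hx with hx | hx
      · rw [map_mul, hx f hf, zero_mul]
      · rw [map_mul, hx g hg, mul_zero]
    rw [IsPrime.vanishingIdeal_zeroLocus] at hfg
    exact (hI.mem_or_mem hfg).elim hfI hgI

/-! ### Codimension two -/

/-- Pullback of polynomials along a parametrization of the hypersurface given by Ptolemy's
relation. -/
def ptolemyPullback : MvPolynomial (Fin 6) ℂ →ₐ[ℂ] MvPolynomial (Fin 6) ℂ :=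
  aeval ![(-X 3 - X 4) * X 5 * X 2, X 4 * X 0 * X 2, X 3 * X 1 * X 2,
    (-X 3 - X 4) * X 0 * X 1, X 4 * X 5 * X 1, X 3 * X 5 * X 0]

theorem ker_ptolemyPullback_le : RingHom.ker ptolemyPullback ≤ RingHom.ker cocircularPullback := by
  have h : cocircularPullback =
      (aeval ![X 0, X 1, X 2, X 3, X 4, -X 0 - X 1 - X 2] :
        MvPolynomial (Fin 6) ℂ →ₐ[ℂ] MvPolynomial (Fin 5) ℂ).comp ptolemyPullback := by
    ext1 i
    fin_cases i <;> simp [cocircularPullback, cocircularPoint, ptolemyPullback]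
  intro f hf
  rw [RingHom.mem_ker] at hf ⊢
  rw [h, AlgHom.comp_apply, hf, map_zero]

theorem ker_ptolemyPullback_ne_bot : RingHom.ker ptolemyPullback ≠ ⊥ := by
  intro h
  -- This is `theta` of the products AX, BY, CZ. They pull back to s², t², r² times a common factor,
  -- with r + s + t = 0, so the Heron factorization makes it vanish.
  let f : MvPolynomial (Fin 6) ℂ := 2 * (X 0 * X 3 * (X 1 * X 4)) + 2 * (X 0 * X 3 * (X 2 * X 5)) +
    2 * (X 1 * X 4 * (X 2 * X 5)) - (X 0 * X 3) ^ 2 - (X 1 * X 4) ^ 2 - (X 2 * X 5) ^ 2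
  have hf : f ∈ RingHom.ker ptolemyPullback := by
    rw [RingHom.mem_ker]
    simp only [f, ptolemyPullback, map_add, map_sub, map_mul, map_pow, map_ofNat, aeval_X,
      Matrix.cons_val]
    ring
  rw [h, Ideal.mem_bot] at hf
  have := congrArg (eval ![1, 0, 0, 1, 0, 0]) hf
  simp [f] at this

theorem cocircularCubic_zero_notMem_ker_ptolemyPullback :
    cocircularCubic 0 ∉ RingHom.ker ptolemyPullback := by
  intro h
  rw [RingHom.mem_ker] at h
  have := congrArg (eval ![1, 1, 1, 1, 2, 3]) h
  simp [cocircularCubic, cocircularMinor, det3, ptolemyPullback] at this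
  norm_num at this

theorem two_le_height_cocircularIdeal : 2 ≤ cocircularIdeal.height := by
  have hle := ker_cocircularPullback ▸ ker_ptolemyPullback_le
  have hlt : RingHom.ker ptolemyPullback < cocircularIdeal :=
    lt_of_le_of_ne hle fun h => cocircularCubic_zero_notMem_ker_ptolemyPullback
      (h ▸ cocircularCubic_mem 0)
  have hP : (RingHom.ker ptolemyPullback).IsPrime := RingHom.ker_isPrime _
  have h0 := Ideal.height_strict_mono_of_isPrime (bot_lt_iff_ne_bot.2 ker_ptolemyPullback_ne_bot)
  have h1 := Ideal.height_strict_mono_of_isPrime hlt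
  rw [Ideal.height_bot] at h0
  have h2 := Order.add_one_le_of_lt h0
  have h3 := Order.add_one_le_of_lt h1
  rw [zero_add] at h2
  calc (2 : ℕ∞) = 1 + 1 := by norm_num
    _ ≤ (RingHom.ker ptolemyPullback).height + 1 := by gcongr
    _ ≤ _ := h3

/-- The ideal lies strictly inside the one generated by A, Y, Z, where v₁, v₂, P have zero mutual
distances. That ideal has height at most 3 by Krull's height theorem. -/
theorem height_cocircularIdeal_le_two : cocircularIdeal.height ≤ 2 := by
  let S : Set (MvPolynomial (Fin 6) ℂ) := {X 0, X 4, X 5}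
  have hX0 : (X 0 : MvPolynomial (Fin 6) ℂ) ∈ Ideal.span S := Ideal.subset_span (by simp [S])
  have hX4 : (X 4 : MvPolynomial (Fin 6) ℂ) ∈ Ideal.span S := Ideal.subset_span (by simp [S])
  have hX5 : (X 5 : MvPolynomial (Fin 6) ℂ) ∈ Ideal.span S := Ideal.subset_span (by simp [S])
  have hle : cocircularIdeal ≤ Ideal.span S := by
    refine Ideal.span_le.2 ?_
    rintro _ ⟨k, rfl⟩
    rw [SetLike.mem_coe, ← Ideal.Quotient.eq_zero_iff_mem, cocircularCubic, map_cocircularMinor,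
      Ideal.Quotient.eq_zero_iff_mem.2 hX0, Ideal.Quotient.eq_zero_iff_mem.2 hX4,
      Ideal.Quotient.eq_zero_iff_mem.2 hX5]
    fin_cases k <;> simp [cocircularMinor, det3] <;> ring
  have hlt : cocircularIdeal < Ideal.span S := by
    refine lt_of_le_of_ne hle fun h => ?_
    rw [← h, ← ker_cocircularPullback, RingHom.mem_ker] at hX0
    have := congrArg (eval ![1, 1, 1, 1, 1]) hX0
    simp [cocircularPullback, cocircularPoint] at this
    norm_num at this
  have hne : Ideal.span S ≠ ⊤ := by
    rw [Ideal.ne_top_iff_one]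
    intro h
    have hker : Ideal.span S ≤
        RingHom.ker (aeval 0 : MvPolynomial (Fin 6) ℂ →ₐ[ℂ] ℂ) := by
      refine Ideal.span_le.2 ?_
      rintro _ (rfl | rfl | rfl) <;> simp
    simpa using hker h
  have hcard : S.ncard ≤ 3 :=
    (Set.ncard_insert_le _ _).trans (Nat.succ_le_succ ((Set.ncard_insert_le _ _).trans_eq (by simp)))
  have h3 : (Ideal.span S).height ≤ 3 :=
    (Ideal.height_le_spanFinrank _ hne).trans
      (Nat.cast_le.2 ((Submodule.spanFinrank_span_le_ncard_of_finite (by simp [S])).trans hcard))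
  have := Order.add_one_le_of_lt ((Ideal.height_strict_mono_of_isPrime hlt).trans_le h3)
  exact (ENat.add_le_add_iff_right ENat.one_ne_top).1 (this.trans (by norm_num))

theorem codimension_cocircularVariety : codimension cocircularVariety = 2 := by
  rw [codimension, vanishingIdeal_cocircularVariety]
  exact le_antisymm height_cocircularIdeal_le_two two_le_height_cocircularIdeal

/-! ### The planar system -/

theorem mem_cocircularVariety_iff {A B C X Y Z : ℂ} :
    ![A, B, C, X, Y, Z] ∈ cocircularVariety ↔ ∀ k, cocircularMinor A B C X Y Z k = 0 := by
  have h (k : Fin 4) : eval ![A, B, C, X, Y, Z] (cocircularCubic k) =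
      cocircularMinor A B C X Y Z k := by
    refine (map_cocircularMinor (eval ![A, B, C, X, Y, Z]) _ _ _ _ _ _ k).trans ?_
    simp
  rw [cocircularVariety, cocircularIdeal, zeroLocus_span]
  simp [h]

/-- Identities checked on the parametrization extend to all of W, including points outside its
image, since the kernel is the ideal. -/
theorem eval_eq_zero_of_mem_cocircularVariety {x : Fin 6 → ℂ} (hx : x ∈ cocircularVariety)
    {f : MvPolynomial (Fin 6) ℂ} (hf : cocircularPullback f = 0) : eval x f = 0 := by
  rw [← aeval_eq_eval]
  exact hx f (ker_cocircularPullback ▸ RingHom.mem_ker.2 hf)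

/-- The equality of the circumradii of the triangle with squared side lengths `X 0, X 1, X 2` and
the triangle with squared side lengths `X i, X j, X k`. -/
def circumradiusPolynomial (i j k : Fin 6) : MvPolynomial (Fin 6) ℂ :=
  X 0 * X 1 * X 2 * (2 * (X i * X j + X i * X k + X j * X k) - (X i ^ 2 + X j ^ 2 + X k ^ 2)) -
    X i * X j * X k * (2 * (X 0 * X 1 + X 0 * X 2 + X 1 * X 2) - (X 0 ^ 2 + X 1 ^ 2 + X 2 ^ 2))

theorem cocircularPullback_circumradiusPolynomial :
    cocircularPullback (circumradiusPolynomial 0 4 5) = 0 ∧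
      cocircularPullback (circumradiusPolynomial 1 3 5) = 0 ∧
      cocircularPullback (circumradiusPolynomial 2 3 4) = 0 := by
  simp only [circumradiusPolynomial, cocircularPullback, cocircularPoint, map_add, map_sub, map_mul,
    map_pow, map_ofNat, aeval_X, Matrix.cons_val]
  refine ⟨?_, ?_, ?_⟩ <;> ring

theorem solvesPlanarSystem_of_mem_cocircularVariety {A B C X Y Z : ℂ} (hθ : theta A B C ≠ 0)
    (h : ![A, B, C, X, Y, Z] ∈ cocircularVariety) :
    SolvesPlanarSystem A B C X Y Z (A * B * C / theta A B C) := by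
  obtain ⟨pA, pB, pC⟩ := cocircularPullback_circumradiusPolynomial
  have hA := eval_eq_zero_of_mem_cocircularVariety h pA
  have hB := eval_eq_zero_of_mem_cocircularVariety h pB
  have hC := eval_eq_zero_of_mem_cocircularVariety h pC
  simp [circumradiusPolynomial] at hA hB hC
  have hmin := mem_cocircularVariety_iff.1 h
  have h0 := hmin 0
  have h1 := hmin 1
  have h2 := hmin 2
  have h3 := hmin 3
  simp only [cocircularMinor, det3, Matrix.cons_val] at h0 h1 h2 h3
  have hdiv {u v : ℂ} (h : A * B * C * u - v * theta A B C = 0) :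
      A * B * C / theta A B C * u - v = 0 := by
    rw [div_mul_eq_mul_div, sub_eq_zero, div_eq_iff hθ]
    linear_combination h
  refine ⟨?_, ?_, ?_, ?_⟩
  -- The Cayley–Menger determinant is an alternating sum of the four minors.
  · linear_combination h1 + h3 - h0 - h2
  · linear_combination hdiv hA
  · linear_combination hdiv hB
  · linear_combination hdiv hC

theorem solvesPlanarSystem_orthocenter {A B C : ℂ} (hθ : theta A B C ≠ 0) :
    SolvesPlanarSystem A B C (A * (B + C - A) ^ 2 / theta A B C)
      (B * (A + C - B) ^ 2 / theta A B C) (C * (A + B - C) ^ 2 / theta A B C)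
      (A * B * C / theta A B C) := by
  -- The denominator is kept as an atom while clearing fractions.
  obtain ⟨t, ht⟩ : ∃ t, t = theta A B C := ⟨_, rfl⟩
  rw [← ht] at hθ ⊢
  have h : t - (2 * (A * B + A * C + B * C) - (A ^ 2 + B ^ 2 + C ^ 2)) = 0 := sub_eq_zero.2 ht
  refine ⟨?_, ?_, ?_, ?_⟩
  all_goals
    field_simp
    rw [ht, theta]
    ring

/-! ### Nondegenerate solutions are orthocenters or cocircular -/

theorem det3_eq_zero {a b c d e f g h i x y z : ℂ} (hz : z ≠ 0) (h₁ : x * a + y * d = z * g)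
    (h₂ : x * b + y * e = z * h) (h₃ : x * c + y * f = z * i) : det3 a b c d e f g h i = 0 := by
  refine (mul_eq_zero.1 (?_ : z * det3 a b c d e f g h i = 0)).resolve_left hz
  unfold det3
  linear_combination (c * e - b * f) * h₁ + (a * f - c * d) * h₂ + (b * d - a * e) * h₃

/-- The main case distinction, in terms of barycentric coordinates `n₀, n₁, n₂` of the point. -/
theorem orthocenter_or_cocircular_of_barycentric {A B C X Y Z ρ n₀ n₁ n₂ : ℂ}
    (hX : X ≠ 0) (hY : Y ≠ 0) (hZ : Z ≠ 0) (h₀ : n₀ ≠ 0) (h₁ : n₁ ≠ 0) (h₂ : n₂ ≠ 0)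
    (e₀ : 2 * X * n₀ + (X + Y - C) * n₁ + (X + Z - B) * n₂ = 0)
    (e₁ : (X + Y - C) * n₀ + 2 * Y * n₁ + (Y + Z - A) * n₂ = 0)
    (e₂ : (X + Z - B) * n₀ + (Y + Z - A) * n₁ + 2 * Z * n₂ = 0)
    (q₀ : 4 * ρ * n₀ ^ 2 = A * Y * Z) (q₁ : 4 * ρ * n₁ ^ 2 = B * X * Z)
    (q₂ : 4 * ρ * n₂ ^ 2 = C * X * Y)
    (hθ : theta A B C = 4 * (n₀ + n₁ + n₂) ^ 2) (hθ0 : theta A B C ≠ 0) :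
    ρ = A * B * C / theta A B C ∧
      ((X = A * (B + C - A) ^ 2 / theta A B C ∧ Y = B * (A + C - B) ^ 2 / theta A B C ∧
        Z = C * (A + B - C) ^ 2 / theta A B C) ∨ ∀ k, cocircularMinor A B C X Y Z k = 0) := by
  obtain ⟨κ, hκ⟩ : ∃ κ, κ * (X * Y * Z) = 4 * ρ := ⟨4 * ρ / (X * Y * Z), by field_simp⟩
  obtain ⟨S, hS⟩ : ∃ S, S = n₀ + n₁ + n₂ := ⟨_, rfl⟩
  obtain ⟨T, hT⟩ : ∃ T, T = X * n₀ + Y * n₁ + Z * n₂ := ⟨_, rfl⟩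
  have hS0 : S ≠ 0 := by
    rintro rfl
    exact hθ0 (by rw [hθ, ← hS]; ring)
  have hA : A = κ * X * n₀ ^ 2 := mul_right_cancel₀ (mul_ne_zero hY hZ) <| by
    linear_combination -q₀ - n₀ ^ 2 * hκ
  have hB : B = κ * Y * n₁ ^ 2 := mul_right_cancel₀ (mul_ne_zero hX hZ) <| by
    linear_combination -q₁ - n₁ ^ 2 * hκ
  have hC : C = κ * Z * n₂ ^ 2 := mul_right_cancel₀ (mul_ne_zero hX hY) <| by
    linear_combination -q₂ - n₂ ^ 2 * hκ
  have f₀ : (S + κ * (n₀ * n₁ * n₂)) * X + T * (1 - κ * (n₁ * n₂)) = 0 := by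
    rw [hS, hT]
    linear_combination e₀ + n₁ * hC + n₂ * hB
  have f₁ : (S + κ * (n₀ * n₁ * n₂)) * Y + T * (1 - κ * (n₀ * n₂)) = 0 := by
    rw [hS, hT]
    linear_combination e₁ + n₀ * hC + n₂ * hA
  have f₂ : (S + κ * (n₀ * n₁ * n₂)) * Z + T * (1 - κ * (n₀ * n₁)) = 0 := by
    rw [hS, hT]
    linear_combination e₂ + n₀ * hB + n₁ * hA
  have hρ (h : S ^ 2 = (κ * (n₀ * n₁ * n₂)) ^ 2) : ρ = A * B * C / theta A B C := by
    rw [eq_div_iff hθ0, hθ, ← hS, h, hA, hB, hC]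
    linear_combination (-κ ^ 2 * (n₀ * n₁ * n₂) ^ 2) * hκ
  have hTS : T * (S - κ * (n₀ * n₁ * n₂)) = 0 := by
    have : 2 * (T * (S - κ * (n₀ * n₁ * n₂))) = 0 := by
      linear_combination n₀ * f₀ + n₁ * f₁ + n₂ * f₂ + (S + κ * (n₀ * n₁ * n₂)) * hT + T * hS
    exact (mul_eq_zero.1 this).resolve_left two_ne_zero
  by_cases hT0 : T = 0
  · have hSκ : S = -(κ * (n₀ * n₁ * n₂)) := by
      rw [hT0, zero_mul, add_zero] at f₀
      exact eq_neg_of_add_eq_zero_left ((mul_eq_zero.1 f₀).resolve_right hX)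
    refine ⟨hρ (by rw [hSκ]; ring), Or.inr ?_⟩
    rw [hT0] at hT
    -- With T = 0, D kills (n₀, n₁, n₂, -S), whose sum is zero. Subtracting the first row of D from
    -- the others removes n₀ and leaves a dependence of three rows, written here column by column.
    have r₀ : n₁ * C + n₂ * B = S * X := by
      rw [hS]
      linear_combination -e₀ - hT
    have r₁ : n₁ * (-C) + n₂ * (A - C) = S * (Y - C) := by
      rw [hS]
      linear_combination -e₁ - hT
    have r₂ : n₁ * (A - B) + n₂ * (-B) = S * (Z - B) := by
      rw [hS]
      linear_combination -e₂ - hT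
    have r₃ : n₁ * (Y - X) + n₂ * (Z - X) = S * (-X) := by
      rw [hS]
      linear_combination -hT
    intro k
    fin_cases k
    · exact det3_eq_zero hS0 r₁ r₂ r₃
    · exact det3_eq_zero hS0 r₀ r₂ r₃
    · exact det3_eq_zero hS0 r₀ r₁ r₃
    · exact det3_eq_zero hS0 r₀ r₁ r₂
  · have hSκ : S = κ * (n₀ * n₁ * n₂) :=
      sub_eq_zero.1 ((mul_eq_zero.1 hTS).resolve_left hT0)
    refine ⟨hρ (by rw [← hSκ]), Or.inl ?_⟩
    have x₀ : 2 * S * n₀ * X = T * (n₁ + n₂) := by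
      linear_combination n₀ * f₀ + (n₀ * X - T) * hSκ + T * hS
    have x₁ : 2 * S * n₁ * Y = T * (n₀ + n₂) := by
      linear_combination n₁ * f₁ + (n₁ * Y - T) * hSκ + T * hS
    have x₂ : 2 * S * n₂ * Z = T * (n₀ + n₁) := by
      linear_combination n₂ * f₂ + (n₂ * Z - T) * hSκ + T * hS
    have a₀ : A = T * (n₁ + n₂) / (2 * (n₁ * n₂)) := by
      rw [eq_div_iff (by simp [h₁, h₂]), hA]
      linear_combination x₀ - 2 * n₀ * X * hSκ
    have a₁ : B = T * (n₀ + n₂) / (2 * (n₀ * n₂)) := by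
      rw [eq_div_iff (by simp [h₀, h₂]), hB]
      linear_combination x₁ - 2 * n₁ * Y * hSκ
    have a₂ : C = T * (n₀ + n₁) / (2 * (n₀ * n₁)) := by
      rw [eq_div_iff (by simp [h₀, h₁]), hC]
      linear_combination x₂ - 2 * n₂ * Z * hSκ
    -- The barycentric coordinates are inverse to B + C - A and its analogues, as for the
    -- orthocenter.
    have b₀ : B + C - A = T / n₀ := by
      rw [a₀, a₁, a₂]
      field_simp
      ring
    have b₁ : A + C - B = T / n₁ := by
      rw [a₀, a₁, a₂]
      field_simp
      ring
    have b₂ : A + B - C = T / n₂ := by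
      rw [a₀, a₁, a₂]
      field_simp
      ring
    have hTT : T ^ 2 = 4 * S * (n₀ * n₁ * n₂) := by
      have h : (A + B - C) * (A + C - B) + (A + B - C) * (B + C - A) +
          (A + C - B) * (B + C - A) = 4 * S ^ 2 := by
        rw [hS, ← hθ, theta]
        ring
      rw [b₀, b₁, b₂] at h
      have e : (T / n₂ * (T / n₁) + T / n₂ * (T / n₀) + T / n₁ * (T / n₀)) * (n₀ * n₁ * n₂) =
          T ^ 2 * S := by
        rw [hS]
        field_simp
      refine mul_left_cancel₀ hS0 ?_
      linear_combination n₀ * n₁ * n₂ * h - e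
    have hS2 : 4 * S ^ 2 ≠ 0 := by simp [hS0]
    rw [hθ, ← hS, b₀, b₁, b₂]
    refine ⟨?_, ?_, ?_⟩
    · rw [eq_div_iff hS2, a₀, div_pow, hTT]
      field_simp
      linear_combination x₀
    · rw [eq_div_iff hS2, a₁, div_pow, hTT]
      field_simp
      linear_combination x₁
    · rw [eq_div_iff hS2, a₂, div_pow, hTT]
      field_simp
      linear_combination x₂

theorem orthocenter_or_cocircular {A B C X Y Z ρ : ℂ} (h : SolvesPlanarSystem A B C X Y Z ρ)
    (hρ : ρ ≠ 0) (hA : A ≠ 0) (hB : B ≠ 0) (hC : C ≠ 0) (hθ : theta A B C ≠ 0) :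
    ρ = A * B * C / theta A B C ∧
      ((X = A * (B + C - A) ^ 2 / theta A B C ∧ Y = B * (A + C - B) ^ 2 / theta A B C ∧
        Z = C * (A + B - C) ^ 2 / theta A B C) ∨ ∀ k, cocircularMinor A B C X Y Z k = 0) := by
  obtain ⟨s₀, s₁, s₂, s₃⟩ := h
  have heq {u v : ℂ} (h : ρ * (u - v) ^ 2 = 0) : u = v :=
    sub_eq_zero.1 (pow_eq_zero_iff two_ne_zero |>.1 ((mul_eq_zero.1 h).resolve_left hρ))
  -- If P has zero squared distance to a vertex, two circle equations become perfect squares that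
  -- give P the distances of that vertex, and the third computes ρ.
  by_cases hX : X = 0
  · subst hX
    have hZ : Z = B := heq (by linear_combination -s₂)
    have hY : Y = C := heq (by linear_combination -s₃)
    subst hZ hY
    refine ⟨?_, Or.inr fun k => ?_⟩
    · rw [eq_div_iff hθ, theta]
      linear_combination s₁
    · fin_cases k <;> simp [cocircularMinor, det3]
  by_cases hY : Y = 0
  · subst hY
    have hZ : Z = A := heq (by linear_combination -s₁)
    have hX : X = C := heq (by linear_combination -s₃)
    subst hZ hX
    refine ⟨?_, Or.inr fun k => ?_⟩
    · rw [eq_div_iff hθ, theta]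
      linear_combination s₂
    · fin_cases k <;> simp [cocircularMinor, det3] <;> ring
  by_cases hZ : Z = 0
  · subst hZ
    have hY : Y = A := heq (by linear_combination -s₁)
    have hX : X = B := heq (by linear_combination -s₂)
    subst hY hX
    refine ⟨?_, Or.inr fun k => ?_⟩
    · rw [eq_div_iff hθ, theta]
      linear_combination s₃
    · fin_cases k <;> simp [cocircularMinor, det3] <;> ring
  -- A square root of a diagonal entry of the adjugate Gram matrix; the off-diagonal entries then
  -- define n₁ and n₂ after division by n₀.
  obtain ⟨n₀, hn₀⟩ := IsAlgClosed.exists_eq_mul_self ((4 * Y * Z - (Y + Z - A) ^ 2) / 4)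
  have q₀ : 4 * ρ * n₀ ^ 2 = A * Y * Z := by
    linear_combination s₁ - 4 * ρ * hn₀
  have h₀ : n₀ ≠ 0 := by
    rintro rfl
    simp [hA, hY, hZ] at q₀
  obtain ⟨n₁, hn₁⟩ : ∃ n₁, 4 * n₀ * n₁ =
      (X + Z - B) * (Y + Z - A) - 2 * Z * (X + Y - C) := ⟨_, mul_div_cancel₀ _ (by simp [h₀])⟩
  obtain ⟨n₂, hn₂⟩ : ∃ n₂, 4 * n₀ * n₂ =
      (X + Y - C) * (Y + Z - A) - 2 * Y * (X + Z - B) := ⟨_, mul_div_cancel₀ _ (by simp [h₀])⟩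
  have h00 : n₀ ^ 2 ≠ 0 := pow_ne_zero 2 h₀
  -- The 2 × 2 minors of the adjugate are multiples of the Gram determinant, which `s₀` makes zero,
  -- so the adjugate has rank one.
  have hm₁ : 4 * n₁ ^ 2 = 4 * X * Z - (X + Z - B) ^ 2 := mul_left_cancel₀ h00 <| by
    linear_combination (4 * n₀ * n₁ + ((X + Z - B) * (Y + Z - A) - 2 * Z * (X + Y - C))) / 4 * hn₁
      + (4 * X * Z - (X + Z - B) ^ 2) * hn₀ - Z / 2 * s₀
  have hm₂ : 4 * n₂ ^ 2 = 4 * X * Y - (X + Y - C) ^ 2 := mul_left_cancel₀ h00 <| by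
    linear_combination (4 * n₀ * n₂ + ((X + Y - C) * (Y + Z - A) - 2 * Y * (X + Z - B))) / 4 * hn₂
      + (4 * X * Y - (X + Y - C) ^ 2) * hn₀ - Y / 2 * s₀
  have hm₁₂ : 4 * n₁ * n₂ = (X + Y - C) * (X + Z - B) - 2 * X * (Y + Z - A) :=
    mul_left_cancel₀ h00 <| by
      linear_combination n₀ * n₂ * hn₁ +
        ((X + Z - B) * (Y + Z - A) - 2 * Z * (X + Y - C)) / 4 * hn₂ +
        ((X + Y - C) * (X + Z - B) - 2 * X * (Y + Z - A)) * hn₀ + (Y + Z - A) / 4 * s₀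
  have q₁ : 4 * ρ * n₁ ^ 2 = B * X * Z := by
    linear_combination s₂ + ρ * hm₁
  have q₂ : 4 * ρ * n₂ ^ 2 = C * X * Y := by
    linear_combination s₃ + ρ * hm₂
  have h₁ : n₁ ≠ 0 := by
    rintro rfl
    simp [hB, hX, hZ] at q₁
  have h₂ : n₂ ≠ 0 := by
    rintro rfl
    simp [hC, hX, hY] at q₂
  refine orthocenter_or_cocircular_of_barycentric hX hY hZ h₀ h₁ h₂ ?_ ?_ ?_ q₀ q₁ q₂ ?_ hθ
  · refine mul_left_cancel₀ h₀ ?_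
    linear_combination -2 * X * hn₀ + (X + Y - C) / 4 * hn₁ + (X + Z - B) / 4 * hn₂ + s₀ / 4
  · refine mul_left_cancel₀ h₀ ?_
    linear_combination -(X + Y - C) * hn₀ + 2 * Y / 4 * hn₁ + (Y + Z - A) / 4 * hn₂
  · refine mul_left_cancel₀ h₀ ?_
    linear_combination -(X + Z - B) * hn₀ + (Y + Z - A) / 4 * hn₁ + 2 * Z / 4 * hn₂
  -- Summing all entries of the adjugate gives θ/4.
  · rw [theta]
    linear_combination 4 * hn₀ - hm₁ - hm₂ - 2 * hn₁ - 2 * hn₂ - 2 * hm₁₂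

end

theorem mainTheorem3 :
    ∃ W : Set (Fin 6 → ℂ),
      IsIrreducibleVariety W ∧ codimension W = 2 ∧ HasDegree W 6 ∧
      ∀ A B C X Y Z ρ : ℂ,
        SolvesPlanarSystem A B C X Y Z ρ ↔
          (theta A B C ≠ 0 ∧ ρ = A * B * C / theta A B C ∧
            X = A * (B + C - A) ^ 2 / theta A B C ∧
            Y = B * (A + C - B) ^ 2 / theta A B C ∧
            Z = C * (A + B - C) ^ 2 / theta A B C) ∨
          (theta A B C ≠ 0 ∧ ρ = A * B * C / theta A B C ∧ ![A, B, C, X, Y, Z] ∈ W) ∨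
          (SolvesPlanarSystem A B C X Y Z ρ ∧
            (ρ = 0 ∨ A = 0 ∨ B = 0 ∨ C = 0 ∨ theta A B C = 0)) := by
  refine ⟨cocircularVariety, isIrreducibleVariety_zeroLocus _, codimension_cocircularVariety,
    hasDegree_cocircularVariety, fun A B C X Y Z ρ => ⟨fun h => ?_, ?_⟩⟩
  · by_cases hdeg : ρ = 0 ∨ A = 0 ∨ B = 0 ∨ C = 0 ∨ theta A B C = 0
    · exact Or.inr (Or.inr ⟨h, hdeg⟩)
    · push Not at hdeg
      obtain ⟨hρ, hA, hB, hC, hθ⟩ := hdeg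
      obtain ⟨hr, ⟨hX, hY, hZ⟩ | hW⟩ := orthocenter_or_cocircular h hρ hA hB hC hθ
      · exact Or.inl ⟨hθ, hr, hX, hY, hZ⟩
      · exact Or.inr (Or.inl ⟨hθ, hr, mem_cocircularVariety_iff.2 hW⟩)
  · rintro (⟨hθ, rfl, rfl, rfl, rfl⟩ | ⟨hθ, rfl, hW⟩ | ⟨h, -⟩)
    · exact solvesPlanarSystem_orthocenter hθ
    · exact solvesPlanarSystem_of_mem_cocircularVariety hθ hW
    · exact h
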